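/- There exists an infinite Sidon sequence of squares $\{a_k\}$ with $a_k\ll k^3(\log k)^8$. That is, there is a strictly increasing sequence of integers $(a_k)$, each of which is the square of an integer, such that $a_k = O\big(k^3(\log k)^8\big)$ as $k\to\infty$ and the set $A=\{a_k\}$ is a Sidon set: whenever $a,b,c,d\in A$ satisfy $a+b=c+d$, one has $\{a,b\}=\{c,d\}$. -/

import Mathlib

/-- A set `A` of integers is a Sidon set if `{a, b} = {c, d}` whenever `a + b = c + d` with
`a, b, c, d ∈ A` (all coincidences among `a, b, c, d` are allowed). -/
def IsSidonSet (A : Set ℤ) : Prop :=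
  ∀ a ∈ A, ∀ b ∈ A, ∀ c ∈ A, ∀ d ∈ A, a + b = c + d → ({a, b} : Set ℤ) = {c, d}

/-! The proof is probabilistic, by deletion. Each `n` in `[8^j, 8^(j+1))` is chosen independently
with probability `p_j = 2^(-j) (j+2)^(-2)`, roughly `n^(-1/3)` up to logarithms, so a block has `7
W_j` expected elements, where `W_j = 8^j p_j = 4^j/(j+2)^2`. An obstruction to the Sidon property is
a solution of `n² + c² = a² + b²` with `c < b ≤ a < n`.

Since `(n-a)(n+a) = (b-c)(b+c)`, the pair `(n, a)` is determined by `b`, `c` and a divisor of `b² -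
c²`. Divisor-function averages cost `(j+2)^3`, so the expected number of solutions with four
distinct entries and `n` in block `j` is `≪ (j+2)^3 p_j² W_j²` (`sum_collisions_lt_le`). Relative to
`W_j` this is `(j+2)^(-3)`, which is summable; solutions with `a = b` contribute even less
(`sum_collisions_eq_le`).

By `exists_set_many_elements_few_configurations`, some outcome has, in all late blocks, many
elements and few solutions. Deleting the largest element of each solution leaves at least `W_j`
elements per late block (`exists_dense_collisionFree`). Hence `k < W_i` forces the `k`-th element
below `8^(i+1)`; its square is `≪ k^3 (log k)^6`, which is more than enough. -/

/-! ### Averages of the divisor function -/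

/-- The harmonic sum as a real number. -/
noncomputable def harmonicSum (N : ℕ) : ℝ := ∑ n ∈ Finset.Ioc 0 N, (1 : ℝ) / n

lemma harmonicSum_nonneg (N : ℕ) : 0 ≤ harmonicSum N :=
  Finset.sum_nonneg fun _ _ => by positivity

lemma harmonicSum_mono {M N : ℕ} (h : M ≤ N) : harmonicSum M ≤ harmonicSum N :=
  Finset.sum_le_sum_of_subset_of_nonneg (Finset.Ioc_subset_Ioc_right h)
    fun _ _ _ => by positivity

lemma harmonicSum_le (N : ℕ) : harmonicSum N ≤ 1 + Real.log N := by
  refine le_trans (le_of_eq ?_) (harmonic_le_one_add_log N)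
  rw [harmonic_eq_sum_Icc, harmonicSum]
  push_cast
  exact Finset.sum_congr (by ext; simp; omega) fun _ _ => by simp

lemma sum_card_divisors_le (N : ℕ) :
    ∑ n ∈ Finset.Ioc 0 N, (n.divisors.card : ℝ) ≤ N * harmonicSum N := by
  have h := ArithmeticFunction.sum_Ioc_sigma0_eq_sum_div N
  simp only [ArithmeticFunction.sigma_zero_apply] at h
  have h' : ∑ n ∈ Finset.Ioc 0 N, (n.divisors.card : ℝ)
      = ∑ n ∈ Finset.Ioc 0 N, ((N / n : ℕ) : ℝ) := by exact_mod_cast h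
  rw [h', harmonicSum, Finset.mul_sum]
  refine Finset.sum_le_sum fun n _ => ?_
  rw [mul_one_div]
  exact Nat.cast_div_le

lemma card_divisorsAntidiagonal_eq (n : ℕ) : n.divisorsAntidiagonal.card = n.divisors.card := by
  rw [← Nat.map_div_right_divisors, Finset.card_map]

/-- The sum runs over pairs with `x * y ≤ N` of `1 / (x * y)`; enlarging the range to `x, y ≤ N`
gives a square. -/
lemma sum_card_divisors_div_le (N : ℕ) :
    ∑ n ∈ Finset.Ioc 0 N, (n.divisors.card : ℝ) / n ≤ harmonicSum N ^ 2 := by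
  let g : ArithmeticFunction ℝ := ⟨fun n => 1 / (n : ℝ), by simp⟩
  have hg : ∀ n, g n = 1 / (n : ℝ) := fun _ => rfl
  have h1 : ∀ n ∈ Finset.Ioc 0 N, (n.divisors.card : ℝ) / n = (g * g) n := by
    intro n _
    rw [ArithmeticFunction.mul_apply, ← card_divisorsAntidiagonal_eq, ← nsmul_one,
      ← Finset.sum_const, Finset.sum_div]
    refine Finset.sum_congr rfl fun x hx => ?_
    rw [hg, hg, ← (Nat.mem_divisorsAntidiagonal.1 hx).1]
    push_cast
    rw [div_mul_div_comm, one_mul]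
  rw [Finset.sum_congr rfl h1, ArithmeticFunction.sum_Ioc_mul_eq_sum_sum, sq]
  conv_rhs => rw [harmonicSum, Finset.sum_mul]
  refine Finset.sum_le_sum fun n _ => ?_
  rw [hg]
  gcongr
  exact harmonicSum_mono (Nat.div_le_self _ _)

lemma card_divisors_mul_le (m n : ℕ) :
    (m * n).divisors.card ≤ m.divisors.card * n.divisors.card := by
  rw [Nat.divisors_mul]
  exact Finset.card_mul_le

/-- The mean square of the divisor function up to `N` is at most the cube of the harmonic sum. -/
lemma sum_card_divisors_sq_le (N : ℕ) :
    ∑ n ∈ Finset.Ioc 0 N, (n.divisors.card : ℝ) ^ 2 ≤ N * harmonicSum N ^ 3 := by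
  -- Writing `d` for the number of divisors, each of the `d(n)` factorizations `n = x y` satisfies
  -- `d(n) ≤ d(x) d(y)`; summing over them bounds `d(n)²` by a Dirichlet convolution.
  have h1 : ∀ n ∈ Finset.Ioc 0 N, (n.divisors.card) ^ 2 ≤
      (ArithmeticFunction.sigma 0 * ArithmeticFunction.sigma 0) n := by
    intro n _
    rw [ArithmeticFunction.mul_apply, sq]
    conv_lhs => rw [← card_divisorsAntidiagonal_eq, ← smul_eq_mul, ← Finset.sum_const]
    refine Finset.sum_le_sum fun x hx => ?_
    rw [card_divisorsAntidiagonal_eq, ← (Nat.mem_divisorsAntidiagonal.1 hx).1]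
    simpa only [ArithmeticFunction.sigma_zero_apply] using card_divisors_mul_le _ _
  have h2 := Finset.sum_le_sum h1
  rw [ArithmeticFunction.sum_Ioc_mul_eq_sum_sum] at h2
  simp only [ArithmeticFunction.sigma_zero_apply] at h2
  have h3 : ∑ n ∈ Finset.Ioc 0 N, (n.divisors.card : ℝ) ^ 2 ≤
      ∑ n ∈ Finset.Ioc 0 N, (n.divisors.card : ℝ) *
        ∑ m ∈ Finset.Ioc 0 (N / n), (m.divisors.card : ℝ) := by exact_mod_cast h2
  calc _ ≤ _ := h3
    _ ≤ ∑ n ∈ Finset.Ioc 0 N, (n.divisors.card : ℝ) * (N / n * harmonicSum N) := by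
        refine Finset.sum_le_sum fun n _ => ?_
        gcongr
        refine (sum_card_divisors_le _).trans ?_
        gcongr
        · exact harmonicSum_nonneg _
        · exact Nat.cast_div_le
        · exact harmonicSum_mono (Nat.div_le_self _ _)
    _ = N * harmonicSum N * ∑ n ∈ Finset.Ioc 0 N, (n.divisors.card : ℝ) / n := by
        rw [Finset.mul_sum]
        exact Finset.sum_congr rfl fun _ _ => by ring
    _ ≤ N * harmonicSum N * harmonicSum N ^ 2 := by
        gcongr
        · exact mul_nonneg (Nat.cast_nonneg _) (harmonicSum_nonneg _)
        · exact sum_card_divisors_div_le N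
    _ = _ := by ring

lemma harmonicSum_two_mul_eight_pow_le (j : ℕ) :
    harmonicSum (2 * 8 ^ (j + 1)) ≤ 3 * ((j : ℝ) + 2) := by
  refine (harmonicSum_le _).trans ?_
  have h : ((2 * 8 ^ (j + 1) : ℕ) : ℝ) = 2 ^ (3 * j + 4) := by
    push_cast
    rw [pow_add 2, pow_mul, pow_succ (8 : ℝ)]
    norm_num
    ring
  rw [h, Real.log_pow]
  have h2 : Real.log 2 ≤ 1 := by linarith [Real.log_two_lt_d9]
  push_cast
  nlinarith [Nat.cast_nonneg (α := ℝ) j]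

lemma sum_card_divisors_sq_eight_pow_le {i j : ℕ} (h : i ≤ j) :
    ∑ n ∈ Finset.Ioc 0 (2 * 8 ^ (i + 1)), (n.divisors.card : ℝ) ^ 2
      ≤ 432 * ((j : ℝ) + 2) ^ 3 * 8 ^ i := by
  refine (sum_card_divisors_sq_le _).trans ?_
  have h1 := harmonicSum_two_mul_eight_pow_le i
  have h2 : (i : ℝ) ≤ j := by exact_mod_cast h
  have h3 : harmonicSum (2 * 8 ^ (i + 1)) ≤ 3 * ((j : ℝ) + 2) := by linarith
  calc _ ≤ ((2 * 8 ^ (i + 1) : ℕ) : ℝ) * (3 * ((j : ℝ) + 2)) ^ 3 := by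
        gcongr
        exact harmonicSum_nonneg _
    _ = _ := by
        push_cast
        ring

/-- For fixed `c`, the average over `b` of the divisor function at the factors of `b² - c²`. -/
lemma sum_card_divisors_sub_mul_add_le {i j c : ℕ} (h : i ≤ j) :
    ∑ b ∈ Finset.range (8 ^ (i + 1)),
      (if c < b then ((b - c).divisors.card * (b + c).divisors.card : ℝ) else 0)
      ≤ 432 * ((j : ℝ) + 2) ^ 3 * 8 ^ i := by
  rw [← Finset.sum_filter]
  -- Both `b - c` and `b + c` are injective in `b` with values below `2 * 8 ^ (i + 1)`, so each mean
  -- square is bounded uniformly in `c`; AM-GM then separates the product.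
  have key : ∀ f : ℕ → ℕ, (∀ b, c < b → 0 < f b ∧ f b < 2 * b) →
      (∀ b b', c < b → c < b' → f b = f b' → b = b') →
      ∑ b ∈ Finset.range (8 ^ (i + 1)) with c < b, ((f b).divisors.card : ℝ) ^ 2
        ≤ 432 * ((j : ℝ) + 2) ^ 3 * 8 ^ i := by
    intro f hf hinj
    refine le_trans ?_ (sum_card_divisors_sq_eight_pow_le h)
    rw [← Finset.sum_image (s := (Finset.range (8 ^ (i + 1))).filter (c < ·)) (g := f)
      (f := fun n => (n.divisors.card : ℝ) ^ 2)]
    · refine Finset.sum_le_sum_of_subset_of_nonneg ?_ fun _ _ _ => by positivity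
      intro n hn
      obtain ⟨b, hb, rfl⟩ := Finset.mem_image.1 hn
      rw [Finset.mem_filter, Finset.mem_range] at hb
      have := hf b hb.2
      rw [Finset.mem_Ioc]
      omega
    · intro b hb b' hb' hbb
      exact hinj b b' (Finset.mem_filter.1 hb).2 (Finset.mem_filter.1 hb').2 hbb
  have h1 := key (fun b => b - c) (fun b hb => by omega) (fun b b' _ _ _ => by omega)
  have h2 := key (fun b => b + c) (fun b hb => by omega) (fun b b' _ _ _ => by omega)
  have h3 : ∑ b ∈ Finset.range (8 ^ (i + 1)) with c < b,
      ((b - c).divisors.card * (b + c).divisors.card : ℝ) ≤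
      ∑ b ∈ Finset.range (8 ^ (i + 1)) with c < b,
      (((b - c).divisors.card : ℝ) ^ 2 + ((b + c).divisors.card : ℝ) ^ 2) / 2 :=
    Finset.sum_le_sum fun b _ => by
      nlinarith [sq_nonneg (((b - c).divisors.card : ℝ) - (b + c).divisors.card)]
  rw [← Finset.sum_div, Finset.sum_add_distrib] at h3
  linarith

/-! ### Random sets: first and second moments -/

open MeasureTheory ProbabilityTheory in
/-- The law of a random subset of `ℕ`, as a Boolean sequence, containing each `n` independently
with probability `p n`. -/
noncomputable def randomSet (p : ℕ → unitInterval) : Measure (ℕ → Bool) :=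
  Measure.infinitePi fun n => bernoulliMeasure true false (p n)

open MeasureTheory ProbabilityTheory in
instance isProbabilityMeasure_randomSet (p : ℕ → unitInterval) :
    IsProbabilityMeasure (randomSet p) := by
  unfold randomSet
  infer_instance

/-- The indicator of the event that the random set contains `F`. -/
noncomputable def containsInd (F : Finset ℕ) : (ℕ → Bool) → ℝ :=
  Set.indicator (Set.pi (F : Set ℕ) fun _ => {true}) 1

lemma containsInd_eq_ite (F : Finset ℕ) (ω : ℕ → Bool) :
    containsInd F ω = if ∀ n ∈ F, ω n = true then 1 else 0 := by
  by_cases h : ∀ n ∈ F, ω n = true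
  · rw [if_pos h, containsInd, Set.indicator_of_mem (by simpa [Set.mem_pi] using h)]
    rfl
  · rw [if_neg h, containsInd, Set.indicator_of_notMem (by simpa [Set.mem_pi] using h)]

lemma containsInd_nonneg (F : Finset ℕ) (ω : ℕ → Bool) : 0 ≤ containsInd F ω := by
  rw [containsInd_eq_ite]
  split_ifs <;> norm_num

lemma containsInd_singleton_mul (m n : ℕ) (ω : ℕ → Bool) :
    containsInd {m} ω * containsInd {n} ω = containsInd {m, n} ω := by
  simp only [containsInd_eq_ite, Finset.mem_singleton, Finset.mem_insert, forall_eq,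
    forall_eq_or_imp]
  cases ω m <;> cases ω n <;> simp

lemma measurableSet_contains (F : Finset ℕ) :
    MeasurableSet (Set.pi (F : Set ℕ) fun _ => ({true} : Set Bool)) :=
  MeasurableSet.pi F.countable_toSet fun _ _ => measurableSet_singleton _

open MeasureTheory in
lemma integrable_containsInd (p : ℕ → unitInterval) (F : Finset ℕ) :
    Integrable (containsInd F) (randomSet p) :=
  (integrable_const (1 : ℝ)).indicator (measurableSet_contains F)

open MeasureTheory ProbabilityTheory in
lemma integral_containsInd (p : ℕ → unitInterval) (F : Finset ℕ) :
    ∫ ω, containsInd F ω ∂(randomSet p) = ∏ n ∈ F, (p n : ℝ) := by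
  unfold containsInd
  rw [integral_indicator_one (measurableSet_contains F), Measure.real, randomSet,
    Measure.infinitePi_pi _ fun _ _ => measurableSet_singleton _, ENNReal.toReal_prod]
  exact Finset.prod_congr rfl fun n _ => by simp

/-- The deviation of the size of the random set in `I`, squared, is a combination of indicators. -/
lemma sq_sum_containsInd_sub (I : Finset ℕ) (E : ℝ) (ω : ℕ → Bool) :
    (∑ n ∈ I, containsInd {n} ω - E) ^ 2 =
      ∑ m ∈ I, ∑ n ∈ I, containsInd {m, n} ω - 2 * E * ∑ n ∈ I, containsInd {n} ω + E ^ 2 := by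
  rw [sub_sq, sq, Finset.sum_mul_sum]
  simp only [containsInd_singleton_mul]
  ring

open MeasureTheory in
lemma integrable_sq_sum_containsInd_sub (p : ℕ → unitInterval) (I : Finset ℕ) (E : ℝ) :
    Integrable (fun ω => (∑ n ∈ I, containsInd {n} ω - E) ^ 2) (randomSet p) := by
  simp only [sq_sum_containsInd_sub]
  refine ((integrable_finsetSum _ fun m _ => integrable_finsetSum _ fun n _ =>
    integrable_containsInd p _).sub ((integrable_finsetSum _ fun n _ =>
    integrable_containsInd p _).const_mul _)).add (integrable_const _)

open MeasureTheory in
-- Off-diagonal terms factor by independence and cancel against the squared mean; the diagonal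
-- contributes at most `p m` for each `m`.
lemma variance_randomSet_le (p : ℕ → unitInterval) (I : Finset ℕ) :
    ∫ ω, (∑ n ∈ I, containsInd {n} ω - ∑ n ∈ I, (p n : ℝ)) ^ 2 ∂(randomSet p)
      ≤ ∑ n ∈ I, (p n : ℝ) := by
  set E := ∑ n ∈ I, (p n : ℝ) with hE
  have i1 : Integrable (fun ω => ∑ n ∈ I, containsInd {n} ω) (randomSet p) :=
    integrable_finsetSum _ fun n _ => integrable_containsInd p _
  have i2 : Integrable (fun ω => ∑ m ∈ I, ∑ n ∈ I, containsInd {m, n} ω) (randomSet p) :=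
    integrable_finsetSum _ fun m _ => integrable_finsetSum _ fun n _ =>
      integrable_containsInd p _
  have i3 : Integrable (fun ω => ∑ m ∈ I, ∑ n ∈ I, containsInd {m, n} ω -
      2 * E * ∑ n ∈ I, containsInd {n} ω) (randomSet p) := i2.sub (i1.const_mul _)
  simp only [sq_sum_containsInd_sub]
  rw [integral_add i3 (integrable_const _), integral_sub i2 (i1.const_mul _), integral_const_mul,
    integral_finsetSum _ fun m _ => integrable_finsetSum _ fun n _ => integrable_containsInd p _,
    integral_finsetSum _ fun n _ => integrable_containsInd p _]
  have h1 : ∀ m ∈ I, ∫ ω, ∑ n ∈ I, containsInd {m, n} ω ∂(randomSet p) ≤ p m * E + p m := by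
    intro m hm
    rw [integral_finsetSum _ fun n _ => integrable_containsInd p _]
    simp only [integral_containsInd]
    rw [hE, Finset.mul_sum, ← Finset.add_sum_erase I _ hm,
      ← Finset.add_sum_erase I (fun n => (p m : ℝ) * p n) hm]
    have : ∑ n ∈ I.erase m, ∏ k ∈ {m, n}, (p k : ℝ) = ∑ n ∈ I.erase m, (p m : ℝ) * p n :=
      Finset.sum_congr rfl fun n hn =>
        Finset.prod_pair (Finset.ne_of_mem_erase hn).symm
    rw [this]
    simp only [Finset.pair_eq_singleton, Finset.prod_singleton]
    nlinarith [mul_self_nonneg (p m : ℝ)]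
  have h2 := Finset.sum_le_sum h1
  rw [Finset.sum_add_distrib, ← Finset.sum_mul, ← hE] at h2
  simp only [integral_containsInd, Finset.prod_singleton, ← hE, integral_const, probReal_univ,
    one_smul]
  nlinarith

open MeasureTheory in
-- By Tonelli the series of the `G j` has finite integral, so it converges almost everywhere and its
-- terms vanish in the limit. This plays the role of Borel–Cantelli.
lemma ae_tendsto_zero_of_summable_integral {Ω : Type*} [MeasurableSpace Ω] {μ : Measure Ω}
    {G : ℕ → Ω → ℝ} {g : ℕ → ℝ} (hi : ∀ j, Integrable (G j) μ) (h0 : ∀ j ω, 0 ≤ G j ω)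
    (hG : ∀ j, ∫ ω, G j ω ∂μ ≤ g j) (hg : Summable g) :
    ∀ᵐ ω ∂μ, Filter.Tendsto (fun j => G j ω) Filter.atTop (nhds 0) := by
  have h1 : ∫⁻ ω, ∑' j, ENNReal.ofReal (G j ω) ∂μ ≠ ⊤ := by
    rw [lintegral_tsum fun j => (hi j).aemeasurable.ennreal_ofReal]
    refine ne_top_of_le_ne_top hg.tsum_ofReal_ne_top (ENNReal.tsum_le_tsum fun j => ?_)
    rw [← ofReal_integral_eq_lintegral_ofReal (hi j) (Filter.Eventually.of_forall (h0 j))]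
    exact ENNReal.ofReal_le_ofReal (hG j)
  filter_upwards [ae_lt_top' (AEMeasurable.tsum
    fun j => (hi j).aemeasurable.ennreal_ofReal) h1] with ω hω
  have h2 := ENNReal.tendsto_atTop_zero_of_tsum_ne_top hω.ne
  have h3 := (ENNReal.tendsto_toReal ENNReal.zero_ne_top).comp h2
  refine h3.congr fun j => ?_
  simp [ENNReal.toReal_ofReal (h0 j ω)]

open Classical in
/-- Existence of a set of integers that has many elements in each of the later blocks `I j` but
contains few of the forbidden configurations `F t`, `t ∈ T j`. -/
theorem exists_set_many_elements_few_configurations {ι : Type*} (p : ℕ → unitInterval)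
    (I : ℕ → Finset ℕ) (T : ℕ → Finset ι) (F : ι → Finset ℕ) (E : ℕ → ℝ)
    (hE : ∀ j, E j = ∑ n ∈ I j, (p n : ℝ)) (hpos : ∀ j, 0 < E j)
    (h1 : Summable fun j => 1 / E j)
    (h2 : Summable fun j => (∑ t ∈ T j, ∏ n ∈ F t, (p n : ℝ)) / E j) :
    ∃ S : Set ℕ, ∀ᶠ j in Filter.atTop,
      E j / 2 ≤ (((I j).filter (· ∈ S)).card : ℝ) ∧
      (((T j).filter fun t => (F t : Set ℕ) ⊆ S).card : ℝ) ≤ E j / 4 := by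
  -- One nonnegative quantity controls both requirements: `G j < 1/16` forces a deviation below `E j
  -- / 4` and fewer than `E j / 16` configurations.
  let G : ℕ → (ℕ → Bool) → ℝ := fun j ω =>
    (∑ n ∈ I j, containsInd {n} ω - E j) ^ 2 / E j ^ 2 + (∑ t ∈ T j, containsInd (F t) ω) / E j
  have i1 : ∀ j, MeasureTheory.Integrable
      (fun ω => (∑ n ∈ I j, containsInd {n} ω - E j) ^ 2 / E j ^ 2) (randomSet p) := fun j =>
    (integrable_sq_sum_containsInd_sub p _ _).div_const _
  have i3 : ∀ j, MeasureTheory.Integrable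
      (fun ω => ∑ t ∈ T j, containsInd (F t) ω) (randomSet p) := fun j =>
    MeasureTheory.integrable_finsetSum _ fun n _ => integrable_containsInd p _
  have i2 : ∀ j, MeasureTheory.Integrable
      (fun ω => (∑ t ∈ T j, containsInd (F t) ω) / E j) (randomSet p) := fun j =>
    (i3 j).div_const _
  have hG : ∀ j, ∫ ω, G j ω ∂(randomSet p) ≤
      1 / E j + (∑ t ∈ T j, ∏ n ∈ F t, (p n : ℝ)) / E j := by
    intro j
    rw [MeasureTheory.integral_add (i1 j) (i2 j), MeasureTheory.integral_div,
      MeasureTheory.integral_div,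
      MeasureTheory.integral_finsetSum _ fun n _ => integrable_containsInd p _]
    simp only [integral_containsInd]
    refine add_le_add_left ?_ _
    rw [div_le_div_iff₀ (pow_pos (hpos j) 2) (hpos j)]
    have := variance_randomSet_le p (I j)
    rw [← hE] at this
    nlinarith [hpos j]
  have hae := ae_tendsto_zero_of_summable_integral (fun j => (i1 j).add (i2 j))
    (fun j ω => add_nonneg (by positivity) (div_nonneg
      (Finset.sum_nonneg fun t _ => containsInd_nonneg _ _) (hpos j).le)) hG (h1.add h2)
  obtain ⟨ω, hω⟩ := hae.exists
  simp only [Pi.add_apply] at hω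
  obtain ⟨S, hS⟩ : ∃ S : Set ℕ, ∀ n, ω n = true ↔ n ∈ S := ⟨{n | ω n = true}, fun _ => Iff.rfl⟩
  refine ⟨S, ?_⟩
  filter_upwards [hω.eventually (gt_mem_nhds (show (0 : ℝ) < 1 / 16 by norm_num))] with j hj
  have c1 : (((I j).filter (· ∈ S)).card : ℝ) = ∑ n ∈ I j, containsInd {n} ω := by
    simp [containsInd_eq_ite, hS]
  have c2 : (((T j).filter fun t => (F t : Set ℕ) ⊆ S).card : ℝ) =
      ∑ t ∈ T j, containsInd (F t) ω := by
    simp [containsInd_eq_ite, hS, Set.subset_def]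
  have hE0 := hpos j
  have a0 : 0 ≤ (∑ t ∈ T j, containsInd (F t) ω) / E j :=
    div_nonneg (Finset.sum_nonneg fun t _ => containsInd_nonneg _ _) hE0.le
  have a1 : 0 ≤ (∑ n ∈ I j, containsInd {n} ω - E j) ^ 2 / E j ^ 2 := by positivity
  constructor
  · have : (∑ n ∈ I j, containsInd {n} ω - E j) ^ 2 / E j ^ 2 < 1 / 16 := by linarith
    rw [div_lt_iff₀ (by positivity)] at this
    have h4 : (∑ n ∈ I j, containsInd {n} ω - E j) ^ 2 < (E j / 4) ^ 2 := by linarith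
    have := abs_lt_of_sq_lt_sq h4 (by positivity)
    refine le_of_le_of_eq ?_ c1.symm
    linarith [(abs_lt.1 this).1]
  · have : (∑ t ∈ T j, containsInd (F t) ω) / E j < 1 / 16 := by linarith
    rw [div_lt_iff₀ hE0] at this
    refine le_of_eq_of_le c2 ?_
    linarith

/-! ### The choice of density -/

/-- The density of the random set in the block `[8 ^ j, 8 ^ (j + 1))`. -/
noncomputable def blockDensity (j : ℕ) : ℝ := 1 / (2 ^ j * ((j : ℝ) + 2) ^ 2)

lemma blockDensity_pos (j : ℕ) : 0 < blockDensity j := by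
  unfold blockDensity
  positivity

lemma blockDensity_le_one (j : ℕ) : blockDensity j ≤ 1 := by
  unfold blockDensity
  have h1 : (1 : ℝ) ≤ 2 ^ j := one_le_pow₀ (by norm_num)
  have h2 : (1 : ℝ) ≤ ((j : ℝ) + 2) ^ 2 := one_le_pow₀ (by linarith [Nat.cast_nonneg (α := ℝ) j])
  rw [div_le_one (by positivity)]
  nlinarith

lemma blockDensity_le_succ (j : ℕ) : blockDensity j ≤ 8 * blockDensity (j + 1) := by
  unfold blockDensity
  have h : (0 : ℝ) ≤ j := Nat.cast_nonneg j
  rw [mul_one_div, div_le_div_iff₀ (by positivity) (by positivity), pow_succ]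
  push_cast
  have : ((j : ℝ) + 1 + 2) ^ 2 ≤ 4 * ((j : ℝ) + 2) ^ 2 := by nlinarith
  have h2 : (0 : ℝ) < 2 ^ j := by positivity
  nlinarith [mul_le_mul_of_nonneg_left this h2.le]

lemma eight_pow_mul_blockDensity (j : ℕ) :
    8 ^ j * blockDensity j = 4 ^ j / ((j : ℝ) + 2) ^ 2 := by
  unfold blockDensity
  rw [mul_one_div, show (8 : ℝ) = 2 * 4 by norm_num, mul_pow,
    mul_div_mul_left _ _ (by positivity)]

/-- The factor 4 outweighs the growth of the polynomial. The shift in `j + 2` matters: at `j = 0`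
the claim is `27 ≤ 32`, and it would fail with `j + 1`. -/
lemma eight_pow_mul_blockDensity_succ (j : ℕ) :
    3 * (8 ^ j * blockDensity j) ≤ 2 * (8 ^ (j + 1) * blockDensity (j + 1)) := by
  rw [eight_pow_mul_blockDensity, eight_pow_mul_blockDensity, mul_div_assoc', mul_div_assoc',
    div_le_div_iff₀ (by positivity) (by positivity), pow_succ (4 : ℝ)]
  push_cast
  have h : (0 : ℝ) ≤ j := Nat.cast_nonneg j
  have : 3 * ((j : ℝ) + 1 + 2) ^ 2 ≤ 8 * ((j : ℝ) + 2) ^ 2 := by nlinarith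
  have h2 : (0 : ℝ) < 4 ^ j := by positivity
  nlinarith [mul_le_mul_of_nonneg_left this h2.le]

/-- The probability of choosing `n`. -/
noncomputable def density (n : ℕ) : unitInterval :=
  ⟨blockDensity (Nat.log 8 n), (blockDensity_pos _).le, blockDensity_le_one _⟩

lemma coe_density (n : ℕ) : (density n : ℝ) = blockDensity (Nat.log 8 n) := rfl

lemma density_nonneg (n : ℕ) : 0 ≤ (density n : ℝ) := (density n).2.1

lemma density_le_one (n : ℕ) : (density n : ℝ) ≤ 1 := (density n).2.2

lemma coe_density_of_mem_block {j n : ℕ} (h1 : 8 ^ j ≤ n) (h2 : n < 8 ^ (j + 1)) :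
    (density n : ℝ) = blockDensity j := by
  rw [coe_density, Nat.log_eq_of_pow_le_of_lt_pow h1 h2]

/-- Weighted sums against the density are governed by the last block. -/
lemma sum_density_mul_le (g : ℕ → ℝ) (hg : ∀ b, 0 ≤ g b) (K : ℝ) (j : ℕ)
    (h : ∀ i ≤ j, ∑ b ∈ Finset.range (8 ^ (i + 1)), g b ≤ K * 8 ^ i) :
    ∑ b ∈ Finset.range (8 ^ (j + 1)), (density b : ℝ) * g b
      ≤ 3 * K * (8 ^ j * blockDensity j) := by
  have hK : 0 ≤ K := by
    have := (Finset.sum_nonneg fun b _ => hg b).trans (h 0 (Nat.zero_le _))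
    simpa using this
  induction j with
  | zero =>
    have h0 := h 0 le_rfl
    have hd : ∀ b ∈ Finset.range (8 ^ (0 + 1)), (density b : ℝ) * g b = blockDensity 0 * g b := by
      intro b hb
      rw [coe_density, Nat.log_of_lt (by simpa using hb)]
    rw [Finset.sum_congr rfl hd, ← Finset.mul_sum]
    have hb := blockDensity_pos 0
    rw [pow_zero, mul_one] at h0
    rw [pow_zero, one_mul]
    nlinarith [mul_le_mul_of_nonneg_left h0 hb.le, mul_nonneg hK hb.le]
  | succ j ih =>
    have h1 := ih fun i hi => h i (by omega)
    have h2 := h (j + 1) le_rfl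
    have hle : 8 ^ (j + 1) ≤ 8 ^ (j + 1 + 1) := Nat.pow_le_pow_right (by norm_num) (by omega)
    rw [← Finset.sum_range_add_sum_Ico _ hle] at h2 ⊢
    have hd : ∀ b ∈ Finset.Ico (8 ^ (j + 1)) (8 ^ (j + 1 + 1)),
        (density b : ℝ) * g b = blockDensity (j + 1) * g b := by
      intro b hb
      rw [Finset.mem_Ico] at hb
      rw [coe_density_of_mem_block hb.1 hb.2]
    rw [Finset.sum_congr rfl hd, ← Finset.mul_sum]
    have h3 : ∑ b ∈ Finset.Ico (8 ^ (j + 1)) (8 ^ (j + 1 + 1)), g b ≤ K * 8 ^ (j + 1) := by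
      linarith [Finset.sum_nonneg fun b (_ : b ∈ Finset.range (8 ^ (j + 1))) => hg b]
    have h4 := mul_le_mul_of_nonneg_left h3 (blockDensity_pos (j + 1)).le
    -- Growth by `3/2` closes the induction with constant 3: `3 W_j + W_(j+1) ≤ 3 W_(j+1)`.
    have h5 := mul_le_mul_of_nonneg_left (eight_pow_mul_blockDensity_succ j) hK
    linarith

/-! ### Expected number of collisions -/

/-- The solutions of `n² + c² = a² + b²` with `c < b ≤ a < n` and `n` in the `j`-th block. -/
def collisions (j : ℕ) : Finset (ℕ × ℕ × ℕ × ℕ) :=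
  (Finset.range (8 ^ (j + 1)) ×ˢ Finset.range (8 ^ (j + 1)) ×ˢ Finset.range (8 ^ (j + 1)) ×ˢ
    Finset.range (8 ^ (j + 1))).filter fun t => 8 ^ j ≤ t.1 ∧ t.2.2.2 < t.2.2.1 ∧ t.2.2.1 ≤ t.2.1 ∧
      t.2.1 < t.1 ∧ t.1 ^ 2 + t.2.2.2 ^ 2 = t.2.1 ^ 2 + t.2.2.1 ^ 2

lemma mem_collisions {j n a b c : ℕ} : (n, a, b, c) ∈ collisions j ↔
    8 ^ j ≤ n ∧ n < 8 ^ (j + 1) ∧ c < b ∧ b ≤ a ∧ a < n ∧ n ^ 2 + c ^ 2 = a ^ 2 + b ^ 2 := by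
  simp only [collisions, Finset.mem_filter, Finset.mem_product, Finset.mem_range]
  constructor
  · rintro ⟨⟨h1, h2, h3, h4⟩, h5, h6, h7, h8, h9⟩
    exact ⟨h5, h1, h6, h7, h8, h9⟩
  · rintro ⟨h5, h1, h6, h7, h8, h9⟩
    exact ⟨⟨h1, by omega, by omega, by omega⟩, h5, h6, h7, h8, h9⟩

/-- The elements of a solution. -/
def support (t : ℕ × ℕ × ℕ × ℕ) : Finset ℕ := {t.1, t.2.1, t.2.2.1, t.2.2.2}

/-- From `n² ≤ a² + b² ≤ 2a²`, the entry `a` lies at most one block below `n`. -/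
lemma density_second_le {j n a b c : ℕ} (h : (n, a, b, c) ∈ collisions j) :
    (density a : ℝ) ≤ 8 * blockDensity j := by
  obtain ⟨h1, h2, h3, h4, h5, h6⟩ := mem_collisions.1 h
  have hn : n ≤ 8 * a := by nlinarith
  by_cases ha : 8 ^ j ≤ a
  · rw [coe_density_of_mem_block ha (by omega)]
    linarith [blockDensity_pos j]
  · cases j with
    | zero => rw [pow_zero] at ha; omega
    | succ j =>
      rw [coe_density_of_mem_block (j := j) (by rw [pow_succ] at h1; omega) (by omega)]
      exact blockDensity_le_succ j

lemma prod_support_le_of_lt {j n a b c : ℕ} (h : (n, a, b, c) ∈ collisions j) (hab : b < a) :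
    ∏ k ∈ support (n, a, b, c), (density k : ℝ) ≤
      8 * blockDensity j ^ 2 * (density b * density c) := by
  obtain ⟨h1, h2, h3, h4, h5, h6⟩ := mem_collisions.1 h
  rw [support, Finset.prod_insert (by simp; omega), Finset.prod_insert (by simp; omega),
    Finset.prod_insert (by simp; omega), Finset.prod_singleton, coe_density_of_mem_block h1 h2]
  have := mul_le_mul_of_nonneg_left (density_second_le h) (mul_nonneg (blockDensity_pos j).le
    (mul_nonneg (density_nonneg b) (density_nonneg c)))
  nlinarith

lemma prod_support_le_of_eq {j n a c : ℕ} (h : (n, a, a, c) ∈ collisions j) :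
    ∏ k ∈ support (n, a, a, c), (density k : ℝ) ≤ 8 * blockDensity j ^ 2 := by
  obtain ⟨h1, h2, h3, h4, h5, h6⟩ := mem_collisions.1 h
  have : support (n, a, a, c) = {n, a, c} := by simp [support]
  rw [this, Finset.prod_insert (by simp; omega), Finset.prod_insert (by simp; omega),
    Finset.prod_singleton, coe_density_of_mem_block h1 h2]
  have h0 := blockDensity_pos j
  have := mul_le_mul (density_second_le h) (density_le_one c) (density_nonneg c) (by linarith)
  nlinarith [mul_le_mul_of_nonneg_left this h0.le]

/-- The expected number of solutions with four distinct elements. -/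
lemma sum_collisions_lt_le (j : ℕ) :
    ∑ t ∈ (collisions j).filter (fun t => t.2.2.1 < t.2.1), ∏ k ∈ support t, (density k : ℝ) ≤
      250000 * ((j : ℝ) + 2) ^ 3 * blockDensity j ^ 2 * (8 ^ j * blockDensity j) ^ 2 := by
  set M := 8 ^ (j + 1) with hM
  have hP := blockDensity_pos j
  -- A solution is encoded by `(c, b)` and the divisor `n - a` of `b² - c²`; the cofactor `n + a`
  -- then recovers `n` and `a`.
  let U : Finset ((_ : ℕ × ℕ) × ℕ) :=
    ((Finset.range M ×ˢ Finset.range M).filter fun x => x.1 < x.2).sigma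
      fun x => ((x.2 - x.1) * (x.2 + x.1)).divisors
  let w : ((_ : ℕ × ℕ) × ℕ) → ℝ := fun y => (density y.1.2 : ℝ) * density y.1.1
  let f : ℕ × ℕ × ℕ × ℕ → ((_ : ℕ × ℕ) × ℕ) := fun t => ⟨(t.2.2.2, t.2.2.1), t.1 - t.2.1⟩
  have step1 : ∑ t ∈ (collisions j).filter (fun t => t.2.2.1 < t.2.1),
      ∏ k ∈ support t, (density k : ℝ) ≤
      8 * blockDensity j ^ 2 * ∑ t ∈ (collisions j).filter (fun t => t.2.2.1 < t.2.1), w (f t) := by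
    rw [Finset.mul_sum]
    refine Finset.sum_le_sum ?_
    rintro ⟨n, a, b, c⟩ ht
    rw [Finset.mem_filter] at ht
    exact prod_support_le_of_lt ht.1 ht.2
  have step2 : ∑ t ∈ (collisions j).filter (fun t => t.2.2.1 < t.2.1), w (f t) ≤ ∑ y ∈ U, w y := by
    rw [← Finset.sum_image (g := f) (f := w)]
    · refine Finset.sum_le_sum_of_subset_of_nonneg ?_ fun y _ _ =>
        mul_nonneg (density_nonneg _) (density_nonneg _)
      intro y hy
      obtain ⟨⟨n, a, b, c⟩, ht, rfl⟩ := Finset.mem_image.1 hy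
      obtain ⟨h1, h2, h3, h4, h5, h6⟩ := mem_collisions.1 (Finset.mem_filter.1 ht).1
      simp only [U, f, Finset.mem_sigma, Finset.mem_filter, Finset.mem_product, Finset.mem_range,
        Nat.mem_divisors]
      refine ⟨⟨⟨by omega, by omega⟩, h3⟩, ⟨n + a, ?_⟩, ?_⟩
      · zify [h5.le, h3.le]
        zify at h6
        linarith
      · have : 0 < (b - c) * (b + c) := Nat.mul_pos (by omega) (by omega)
        omega
    · rintro ⟨n, a, b, c⟩ ht ⟨n', a', b', c'⟩ ht' hff
      obtain ⟨h1, h2, h3, h4, h5, h6⟩ := mem_collisions.1 (Finset.mem_filter.1 ht).1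
      obtain ⟨h1', h2', h3', h4', h5', h6'⟩ := mem_collisions.1 (Finset.mem_filter.1 ht').1
      simp only [f, Sigma.mk.injEq, Prod.mk.injEq, heq_eq_eq] at hff
      obtain ⟨⟨rfl, rfl⟩, hd⟩ := hff
      have hn : n' = n + a' - a := by omega
      obtain ⟨d, rfl⟩ : ∃ d, n = a + d := ⟨n - a, by omega⟩
      obtain rfl : n' = a' + d := by omega
      have hd0 : 0 < d := by omega
      have : d * a = d * a' := by nlinarith
      obtain rfl := Nat.eq_of_mul_eq_mul_left hd0 this
      rfl
  have step3 : ∑ y ∈ U, w y ≤ ∑ c ∈ Finset.range M, (density c : ℝ) *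
      ∑ b ∈ Finset.range M, (density b : ℝ) *
        (if c < b then ((b - c).divisors.card * (b + c).divisors.card : ℝ) else 0) := by
    rw [Finset.sum_sigma, Finset.sum_filter, Finset.sum_product]
    refine Finset.sum_le_sum fun c _ => ?_
    rw [Finset.mul_sum]
    refine Finset.sum_le_sum fun b _ => ?_
    split_ifs with hcb
    · simp only [w, Finset.sum_const, nsmul_eq_mul]
      have : (((b - c) * (b + c)).divisors.card : ℝ) ≤
          ((b - c).divisors.card * (b + c).divisors.card : ℝ) := by
        exact_mod_cast card_divisors_mul_le _ _
      have h0 := mul_nonneg (density_nonneg b) (density_nonneg c)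
      nlinarith [mul_le_mul_of_nonneg_left this h0]
    · simp
  have step4 : ∀ c, ∑ b ∈ Finset.range M, (density b : ℝ) *
      (if c < b then ((b - c).divisors.card * (b + c).divisors.card : ℝ) else 0) ≤
      3 * (432 * ((j : ℝ) + 2) ^ 3) * (8 ^ j * blockDensity j) := fun c =>
    sum_density_mul_le _ (fun b => by split_ifs <;> positivity) _ j
      fun i hi => sum_card_divisors_sub_mul_add_le hi
  have step5 : ∑ c ∈ Finset.range M, (density c : ℝ) ≤ 3 * 8 * (8 ^ j * blockDensity j) := by
    have := sum_density_mul_le (fun _ => 1) (fun _ => zero_le_one) 8 j fun i _ => by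
      simp [pow_succ, mul_comm]
    simpa only [mul_one] using this
  have step6 : ∑ c ∈ Finset.range M, (density c : ℝ) *
      ∑ b ∈ Finset.range M, (density b : ℝ) *
        (if c < b then ((b - c).divisors.card * (b + c).divisors.card : ℝ) else 0) ≤
      3 * 8 * (8 ^ j * blockDensity j) *
        (3 * (432 * ((j : ℝ) + 2) ^ 3) * (8 ^ j * blockDensity j)) := by
    refine (Finset.sum_le_sum fun c _ =>
      mul_le_mul_of_nonneg_left (step4 c) (density_nonneg c)).trans ?_
    rw [← Finset.sum_mul]
    exact mul_le_mul_of_nonneg_right step5 (by positivity)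
  have h8 : (0 : ℝ) ≤ 8 * blockDensity j ^ 2 := by positivity
  refine step1.trans ((mul_le_mul_of_nonneg_left (step2.trans (step3.trans step6)) h8).trans ?_)
  have : 0 ≤ ((j : ℝ) + 2) ^ 3 * blockDensity j ^ 2 * (8 ^ j * blockDensity j) ^ 2 := by positivity
  nlinarith

/-- With `n = c + u`, this is `(n - c)² = (2a - n - c)(2a + n + c)`, so `u` and its divisor `v`
determine the solution. -/
lemma sq_eq_of_sq_add_sq_eq_two_mul_sq {a c u v : ℕ} (h : (c + u) ^ 2 + c ^ 2 = a ^ 2 + a ^ 2)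
    (hv : 2 * a = 2 * c + u + v) : u * u = v * (2 * (2 * c + u) + v) := by
  have : (2 * a) * (2 * a) = (2 * c + u + v) * (2 * c + u + v) := by rw [hv]
  linarith

/-- The expected number of solutions with three distinct elements. -/
lemma sum_collisions_eq_le (j : ℕ) :
    ∑ t ∈ (collisions j).filter (fun t => ¬ t.2.2.1 < t.2.1), ∏ k ∈ support t, (density k : ℝ) ≤
      4000 * ((j : ℝ) + 2) ^ 3 * blockDensity j ^ 2 * 8 ^ j := by
  have hP := blockDensity_pos j
  let U : Finset ((_ : ℕ) × ℕ) :=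
    (Finset.Ioc 0 (2 * 8 ^ (j + 1))).sigma fun x => (x * x).divisors
  let f : ℕ × ℕ × ℕ × ℕ → ((_ : ℕ) × ℕ) := fun t => ⟨t.1 - t.2.2.2, 2 * t.2.1 - t.1 - t.2.2.2⟩
  -- Strict convexity of squares; it makes the truncated subtraction in `f` genuine and the divisor
  -- positive.
  have hle : ∀ {n a c : ℕ}, (n, a, a, c) ∈ collisions j → n + c < 2 * a := by
    intro n a c h
    obtain ⟨h1, h2, h3, h4, h5, h6⟩ := mem_collisions.1 h
    by_contra hcon
    obtain ⟨k, hk⟩ := Nat.exists_eq_add_of_lt (h3.trans h5)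
    subst hk
    nlinarith
  have hcard : ((collisions j).filter (fun t => ¬ t.2.2.1 < t.2.1)).card ≤ U.card := by
    refine Finset.card_le_card_of_injOn f ?_ ?_
    · rintro ⟨n, a, b, c⟩ ht
      obtain ⟨ht, hba⟩ := Finset.mem_filter.1 ht
      obtain ⟨h1, h2, h3, h4, h5, h6⟩ := mem_collisions.1 ht
      obtain rfl : a = b := by simp only at hba; omega
      have hlt := hle ht
      simp only [U, f, Finset.mem_coe, Finset.mem_sigma, Finset.mem_Ioc, Nat.mem_divisors]
      refine ⟨by omega, ⟨2 * a + n + c, ?_⟩, ?_⟩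
      · rw [Nat.sub_sub]
        zify [hlt.le, (h3.trans h5).le]
        zify at h6
        linarith
      · have : 0 < (n - c) * (n - c) := Nat.mul_pos (by omega) (by omega)
        omega
    · rintro ⟨n, a, b, c⟩ ht ⟨n', a', b', c'⟩ ht' hff
      obtain ⟨ht, hba⟩ := Finset.mem_filter.1 ht
      obtain ⟨ht', hba'⟩ := Finset.mem_filter.1 ht'
      obtain ⟨h1, h2, h3, h4, h5, h6⟩ := mem_collisions.1 ht
      obtain ⟨h1', h2', h3', h4', h5', h6'⟩ := mem_collisions.1 ht'
      obtain rfl : a = b := by simp only at hba; omega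
      obtain rfl : a' = b' := by simp only at hba'; omega
      have hlt := hle ht
      have hlt' := hle ht'
      simp only [f, Sigma.mk.injEq, heq_eq_eq] at hff
      obtain ⟨e1, e2⟩ := hff
      obtain ⟨u, rfl⟩ : ∃ u, n = c + u := ⟨n - c, by omega⟩
      obtain rfl : n' = c' + u := by omega
      obtain ⟨v, hv⟩ : ∃ v, 2 * a = 2 * c + u + v := ⟨2 * a - (c + u) - c, by omega⟩
      have hv' : 2 * a' = 2 * c' + u + v := by omega
      have hv0 : 0 < v := by omega
      have k1 := sq_eq_of_sq_add_sq_eq_two_mul_sq h6 hv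
      have k2 := sq_eq_of_sq_add_sq_eq_two_mul_sq h6' hv'
      have k3 := Nat.eq_of_mul_eq_mul_left hv0 (k1.symm.trans k2)
      obtain rfl : c = c' := by omega
      obtain rfl : a = a' := by omega
      rfl
  have hU : (U.card : ℝ) ≤ 432 * ((j : ℝ) + 2) ^ 3 * 8 ^ j := by
    refine le_trans ?_ (sum_card_divisors_sq_eight_pow_le le_rfl)
    rw [Finset.card_sigma]
    push_cast
    refine Finset.sum_le_sum fun n _ => ?_
    rw [sq]
    exact_mod_cast card_divisors_mul_le n n
  have h1 : ∀ t ∈ (collisions j).filter (fun t => ¬ t.2.2.1 < t.2.1),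
      ∏ k ∈ support t, (density k : ℝ) ≤ 8 * blockDensity j ^ 2 := by
    rintro ⟨n, a, b, c⟩ ht
    obtain ⟨ht, hba⟩ := Finset.mem_filter.1 ht
    obtain rfl : a = b := by
      have := (mem_collisions.1 ht).2.2.2.1
      simp only at hba
      omega
    exact prod_support_le_of_eq ht
  refine (Finset.sum_le_card_nsmul _ _ _ h1).trans ?_
  rw [nsmul_eq_mul]
  have h2 : (((collisions j).filter (fun t => ¬ t.2.2.1 < t.2.1)).card : ℝ) ≤ _ :=
    (Nat.cast_le.2 hcard).trans hU
  refine (mul_le_mul_of_nonneg_right h2 (by positivity)).trans ?_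
  have : 0 ≤ ((j : ℝ) + 2) ^ 3 * blockDensity j ^ 2 * 8 ^ j := by positivity
  nlinarith

/-! ### Summability over blocks -/

lemma sum_density_block (j : ℕ) :
    ∑ n ∈ Finset.Ico (8 ^ j) (8 ^ (j + 1)), (density n : ℝ) = 7 * (8 ^ j * blockDensity j) := by
  have h : ∀ n ∈ Finset.Ico (8 ^ j) (8 ^ (j + 1)), (density n : ℝ) = blockDensity j := by
    intro n hn
    rw [Finset.mem_Ico] at hn
    exact coe_density_of_mem_block hn.1 hn.2
  rw [Finset.sum_congr rfl h, Finset.sum_const, Nat.card_Ico, nsmul_eq_mul,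
    show 8 ^ (j + 1) - 8 ^ j = 7 * 8 ^ j by rw [pow_succ]; omega]
  push_cast
  ring

lemma summable_add_two_pow_mul_geometric (m : ℕ) {r : ℝ} (h0 : 0 < r) (h1 : r < 1) :
    Summable fun j : ℕ => ((j : ℝ) + 2) ^ m * r ^ j := by
  have h' : Summable fun n : ℕ => (n : ℝ) ^ m * r ^ n :=
    summable_pow_mul_geometric_of_norm_lt_one m (by rwa [Real.norm_of_nonneg h0.le])
  have h := (summable_nat_add_iff 2).2 h'
  refine (h.mul_right (r ^ 2)⁻¹).congr fun j => ?_
  push_cast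
  rw [pow_add]
  field_simp

lemma summable_inv_block_weight :
    Summable fun j : ℕ => 1 / (7 * (8 ^ j * blockDensity j)) := by
  refine ((summable_add_two_pow_mul_geometric 2 (r := 1 / 4) (by norm_num)
    (by norm_num)).mul_left (1 / 7)).congr fun j => ?_
  rw [eight_pow_mul_blockDensity, one_div_pow]
  field_simp

/-- The density is tuned here: `8^j p_j^3 = (j+2)^(-6)` beats the divisor cost `(j+2)^3`, leaving
`(j+2)^(-3)`; the case `a = b` leaves `(j+2) 2^(-j)`. -/
lemma summable_expected_collisions :
    Summable fun j : ℕ => (∑ t ∈ collisions j, ∏ k ∈ support t, (density k : ℝ)) /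
      (7 * (8 ^ j * blockDensity j)) := by
  have s1 : Summable fun j : ℕ => (250000 / 7 : ℝ) * (1 / ((j : ℝ) + 2) ^ 3) := by
    have := (summable_nat_add_iff 2).2 (Real.summable_one_div_nat_pow.2 (show 1 < 3 by norm_num))
    push_cast at this
    exact this.mul_left _
  have s2 := (summable_add_two_pow_mul_geometric 1 (r := 1 / 2) (by norm_num)
    (by norm_num)).mul_left (4000 / 7)
  refine Summable.of_nonneg_of_le (fun j => ?_) (fun j => ?_) (s1.add s2)
  · have := blockDensity_pos j
    exact div_nonneg (Finset.sum_nonneg fun t _ => Finset.prod_nonneg fun k _ => density_nonneg k)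
      (by positivity)
  · have hP := blockDensity_pos j
    rw [div_le_iff₀ (by positivity),
      ← Finset.sum_filter_add_sum_filter_not _ (fun t => t.2.2.1 < t.2.1)]
    refine (add_le_add (sum_collisions_lt_le j) (sum_collisions_eq_le j)).trans (le_of_eq ?_)
    rw [add_mul]
    have hd : blockDensity j = 1 / (2 ^ j * ((j : ℝ) + 2) ^ 2) := rfl
    have h8 : (8 : ℝ) ^ j = 2 ^ j * 2 ^ j * 2 ^ j := by
      rw [← mul_pow, ← mul_pow]
      norm_num
    congr 1
    · rw [hd, h8]
      field_simp
    · rw [hd, h8, one_div_pow (2 : ℝ) j]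
      field_simp

/-! ### Deletion and the Sidon property -/

/-- The set of elements of `S` that are not the largest element of a solution in `S`. -/
def collisionFree (S : Set ℕ) : Set ℕ :=
  {n | n ∈ S ∧ ∀ a ∈ S, ∀ b ∈ S, ∀ c ∈ S, c < b → b ≤ a → a < n → n ^ 2 + c ^ 2 ≠ a ^ 2 + b ^ 2}

/-- If `z < x`, then `y < w`, and `x` would be the largest entry of a forbidden solution. -/
lemma eq_and_eq_of_mem_collisionFree {S : Set ℕ} {x y z w : ℕ} (hx : x ∈ collisionFree S)
    (hy : y ∈ collisionFree S) (hz : z ∈ collisionFree S) (hw : w ∈ collisionFree S)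
    (hwz : w ≤ z) (hzx : z ≤ x) (h : x ^ 2 + y ^ 2 = z ^ 2 + w ^ 2) : x = z ∧ y = w := by
  rcases hzx.eq_or_lt with rfl | hlt
  · exact ⟨rfl, (Nat.pow_left_inj (n := 2) (by norm_num)).1 (by omega)⟩
  · have h1 : y < w := by nlinarith
    exact absurd h (hx.2 z hz.1 w hw.1 y hy.1 h1 hwz hlt)

lemma pair_eq_of_mem_collisionFree {S : Set ℕ} {x y z w : ℕ} (hx : x ∈ collisionFree S)
    (hy : y ∈ collisionFree S) (hz : z ∈ collisionFree S) (hw : w ∈ collisionFree S)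
    (h : x ^ 2 + y ^ 2 = z ^ 2 + w ^ 2) : (x = z ∧ y = w) ∨ (x = w ∧ y = z) := by
  have key : ∀ x y z w, x ∈ collisionFree S → y ∈ collisionFree S → z ∈ collisionFree S →
      w ∈ collisionFree S → y ≤ x → w ≤ z → x ^ 2 + y ^ 2 = z ^ 2 + w ^ 2 → x = z ∧ y = w := by
    intro x y z w hx hy hz hw hyx hwz h
    rcases le_total z x with hzx | hxz
    · exact eq_and_eq_of_mem_collisionFree hx hy hz hw hwz hzx h
    · have := eq_and_eq_of_mem_collisionFree hz hw hx hy hyx hxz h.symm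
      exact ⟨this.1.symm, this.2.symm⟩
  rcases le_total y x with h1 | h1 <;> rcases le_total w z with h2 | h2
  · exact Or.inl (key x y z w hx hy hz hw h1 h2 h)
  · exact Or.inr (key x y w z hx hy hw hz h1 h2 (by omega))
  · exact Or.inr (key y x z w hy hx hz hw h1 h2 (by omega)).symm
  · exact Or.inl (key y x w z hy hx hw hz h1 h2 (by omega)).symm

lemma isSidonSet_range_sq {S : Set ℕ} {f : ℕ → ℕ} (hf : ∀ k, f k ∈ collisionFree S) :
    IsSidonSet (Set.range fun k => (f k : ℤ) ^ 2) := by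
  rintro _ ⟨x, rfl⟩ _ ⟨y, rfl⟩ _ ⟨z, rfl⟩ _ ⟨w, rfl⟩ h
  have h' : f x ^ 2 + f y ^ 2 = f z ^ 2 + f w ^ 2 := by
    dsimp only at h
    exact_mod_cast h
  rcases pair_eq_of_mem_collisionFree (hf x) (hf y) (hf z) (hf w) h' with ⟨h1, h2⟩ | ⟨h1, h2⟩
  · simp only [h1, h2]
  · simp only [h1, h2]
    exact Set.pair_comm _ _

open Classical in
/-- There is a set without collisions that is dense in each of the later blocks. -/
lemma exists_dense_collisionFree : ∃ S : Set ℕ, ∀ᶠ j in Filter.atTop,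
    (8 ^ j * blockDensity j : ℝ) ≤
      (((Finset.Ico (8 ^ j) (8 ^ (j + 1))).filter (· ∈ collisionFree S)).card : ℝ) := by
  obtain ⟨S, hS⟩ := exists_set_many_elements_few_configurations density
    (fun j => Finset.Ico (8 ^ j) (8 ^ (j + 1))) collisions support
    (fun j => 7 * (8 ^ j * blockDensity j)) (fun j => (sum_density_block j).symm)
    (fun j => by have := blockDensity_pos j; positivity) summable_inv_block_weight
    summable_expected_collisions
  refine ⟨S, hS.mono fun j ⟨h1, h2⟩ => ?_⟩
  set I := Finset.Ico (8 ^ j) (8 ^ (j + 1)) with hI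
  have hsub : I.filter (· ∈ S) ⊆ I.filter (· ∈ collisionFree S) ∪
      ((collisions j).filter fun t => (support t : Set ℕ) ⊆ S).image Prod.fst := by
    intro n hn
    obtain ⟨hnI, hnS⟩ := Finset.mem_filter.1 hn
    rw [Finset.mem_union]
    by_cases hc : n ∈ collisionFree S
    · exact Or.inl (Finset.mem_filter.2 ⟨hnI, hc⟩)
    · right
      simp only [collisionFree, Set.mem_ofPred_eq, not_and, not_forall] at hc
      obtain ⟨a, ha, b, hb, c, hc, h1, h2, h3, h4⟩ := hc hnS
      rw [not_not] at h4
      rw [hI, Finset.mem_Ico] at hnI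
      refine Finset.mem_image.2 ⟨(n, a, b, c), Finset.mem_filter.2
        ⟨mem_collisions.2 ⟨hnI.1, hnI.2, h1, h2, h3, h4⟩, ?_⟩, rfl⟩
      intro x hx
      simp only [support, Finset.coe_insert, Finset.coe_singleton, Set.mem_insert_iff,
        Set.mem_singleton_iff] at hx
      rcases hx with rfl | rfl | rfl | rfl <;> assumption
  -- With expectation `7 W_j`, at least `7/2 - 7/4 = 7/4` times `W_j` elements survive.
  have h3 := (Finset.card_le_card hsub).trans ((Finset.card_union_le _ _).trans
    (Nat.add_le_add_left Finset.card_image_le _))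
  have h4 : ((I.filter (· ∈ S)).card : ℝ) ≤ ((I.filter (· ∈ collisionFree S)).card : ℝ) +
      (((collisions j).filter fun t => (support t : Set ℕ) ⊆ S).card : ℝ) := by exact_mod_cast h3
  have := mul_pos (pow_pos (show (0 : ℝ) < 8 by norm_num) j) (blockDensity_pos j)
  linarith

/-! ### Growth of the sequence -/

lemma three_halves_pow_le (j : ℕ) : (3 / 2 : ℝ) ^ j ≤ 4 * (8 ^ j * blockDensity j) := by
  induction j with
  | zero => norm_num [blockDensity]
  | succ j ih =>
    rw [pow_succ]
    linarith [eight_pow_mul_blockDensity_succ j]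

lemma monotone_block_weight : Monotone fun j : ℕ => (8 ^ j * blockDensity j : ℝ) :=
  monotone_nat_of_le_succ fun j => by
    have := mul_pos (pow_pos (show (0 : ℝ) < 8 by norm_num) j) (blockDensity_pos j)
    linarith [eight_pow_mul_blockDensity_succ j]

/-- Each large integer lies between two consecutive values of `8 ^ i * blockDensity i`. -/
lemma exists_block_weight_le_lt (J : ℕ) (x : ℝ) (hx : 8 ^ J * blockDensity J ≤ x) :
    ∃ i, J ≤ i ∧ 8 ^ i * blockDensity i ≤ x ∧ x < 8 ^ (i + 1) * blockDensity (i + 1) := by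
  have hex : ∃ j : ℕ, x < 8 ^ j * blockDensity j := by
    obtain ⟨j, hj⟩ := pow_unbounded_of_one_lt (4 * x) (show (1 : ℝ) < 3 / 2 by norm_num)
    exact ⟨j, by linarith [three_halves_pow_le j]⟩
  classical
  have h1 := Nat.find_spec hex
  have h2 : J < Nat.find hex := by
    by_contra hcon
    linarith [monotone_block_weight (not_lt.1 hcon)]
  obtain ⟨i, hi⟩ : ∃ i, Nat.find hex = i + 1 := ⟨Nat.find hex - 1, by omega⟩
  refine ⟨i, by omega, not_lt.1 (Nat.find_min hex (by omega)), hi ▸ h1⟩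

/-- Take logarithms in `(3/2)^i ≤ 4x` and use `log (3/2) ≥ 1/3`; `20 ≤ i` absorbs the additive
constants. -/
lemma add_two_le_six_mul_log {i : ℕ} {x : ℝ} (hi : 20 ≤ i) (hx : 8 ^ i * blockDensity i ≤ x) :
    (i : ℝ) + 2 ≤ 6 * Real.log x := by
  have h1 : (3 / 2 : ℝ) ^ i ≤ 4 * x := by linarith [three_halves_pow_le i]
  have h0 : (0 : ℝ) < (3 / 2) ^ i := by positivity
  have h2 := Real.log_le_log h0 h1
  have hx0 : 0 < x := by linarith
  rw [Real.log_pow, Real.log_mul (by norm_num) hx0.ne', show (4 : ℝ) = 2 ^ 2 by norm_num,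
    Real.log_pow] at h2
  have h3 := Real.one_sub_inv_le_log_of_pos (show (0 : ℝ) < 3 / 2 by norm_num)
  have h4 : (20 : ℝ) ≤ i := by exact_mod_cast hi
  have h5 := Real.log_two_lt_d9
  push_cast at h2
  norm_num at h3
  nlinarith

lemma isBigO_of_nth_lt {f : ℕ → ℕ} {J : ℕ}
    (h : ∀ i k : ℕ, J ≤ i → (k : ℝ) < 8 ^ i * blockDensity i → f k < 8 ^ (i + 1)) :
    Asymptotics.IsBigO Filter.atTop (fun k : ℕ => (((f k : ℤ) ^ 2 : ℤ) : ℝ))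
      (fun k : ℕ => (k : ℝ) ^ 3 * Real.log (k : ℝ) ^ 8) := by
  refine Asymptotics.IsBigO.of_bound (4096 * 6 ^ 8) ?_
  have hev : ∀ᶠ k : ℕ in Filter.atTop,
      (8 ^ (max J 20) * blockDensity (max J 20) : ℝ) ≤ k :=
    tendsto_natCast_atTop_atTop.eventually_ge_atTop _
  filter_upwards [hev] with k hk
  obtain ⟨i, hi, h1, h2⟩ := exists_block_weight_le_lt _ _ hk
  have hJ : J ≤ i + 1 := (le_max_left _ _).trans (hi.trans (Nat.le_succ i))
  have hf := h (i + 1) k hJ h2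
  have hlog := add_two_le_six_mul_log ((le_max_right _ _).trans hi) h1
  have hf' : (f k : ℝ) ≤ 8 ^ (i + 1 + 1) := by exact_mod_cast hf.le
  have h3 : (64 : ℝ) ^ i ≤ (k : ℝ) ^ 3 * ((i : ℝ) + 2) ^ 6 := by
    rw [eight_pow_mul_blockDensity, div_le_iff₀ (by positivity)] at h1
    calc (64 : ℝ) ^ i = (4 ^ i) ^ 3 := by rw [← pow_mul, mul_comm, pow_mul]; norm_num
      _ ≤ ((k : ℝ) * ((i : ℝ) + 2) ^ 2) ^ 3 := by gcongr
      _ = _ := by ring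
  -- Exponent 6 is what the construction yields; it is relaxed to 8 using `i + 2 ≥ 1`.
  have h4 : ((i : ℝ) + 2) ^ 6 ≤ (6 * Real.log k) ^ 8 :=
    (pow_le_pow_right₀ (by linarith [Nat.cast_nonneg (α := ℝ) i]) (by norm_num)).trans
      (pow_le_pow_left₀ (by positivity) hlog 8)
  push_cast
  rw [Real.norm_of_nonneg (by positivity), Real.norm_of_nonneg (by positivity)]
  calc (f k : ℝ) ^ 2 ≤ (8 ^ (i + 1 + 1)) ^ 2 := by gcongr
    _ = 4096 * 64 ^ i := by
        rw [← pow_mul, mul_comm, pow_mul, pow_add, pow_add]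
        norm_num
        ring
    _ ≤ 4096 * ((k : ℝ) ^ 3 * (6 * Real.log k) ^ 8) := by
        have : (k : ℝ) ^ 3 * ((i : ℝ) + 2) ^ 6 ≤ (k : ℝ) ^ 3 * (6 * Real.log k) ^ 8 := by gcongr
        linarith
    _ = _ := by ring

theorem mainTheorem2 :
    ∃ a : ℕ → ℤ, StrictMono a ∧ (∀ k, IsSquare (a k)) ∧ IsSidonSet (Set.range a) ∧
      Asymptotics.IsBigO Filter.atTop (fun k : ℕ => (a k : ℝ))
        (fun k : ℕ => (k : ℝ) ^ 3 * Real.log (k : ℝ) ^ 8) := by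
  classical
  obtain ⟨S, hS⟩ := exists_dense_collisionFree
  obtain ⟨J, hJ⟩ := Filter.eventually_atTop.1 hS
  have hinf : {n | n ∈ collisionFree S}.Infinite := by
    refine Set.infinite_of_forall_exists_gt fun m => ?_
    have hm := hJ (max J (m + 1)) (le_max_left _ _)
    have hpos := mul_pos (pow_pos (show (0 : ℝ) < 8 by norm_num) (max J (m + 1)))
      (blockDensity_pos (max J (m + 1)))
    obtain ⟨n, hn⟩ := Finset.card_pos.1 (by exact_mod_cast hpos.trans_le hm)
    obtain ⟨hnI, hnA⟩ := Finset.mem_filter.1 hn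
    have h1 : max J (m + 1) < 8 ^ max J (m + 1) := Nat.lt_pow_self (by norm_num)
    have h2 : m + 1 ≤ max J (m + 1) := le_max_right _ _
    exact ⟨n, hnA, by linarith [(Finset.mem_Ico.1 hnI).1]⟩
  have hmono := Nat.nth_strictMono hinf
  refine ⟨fun k => (Nat.nth (· ∈ collisionFree S) k : ℤ) ^ 2, ?_, fun k => IsSquare.sq _,
    isSidonSet_range_sq fun k => Nat.nth_mem_of_infinite hinf k, isBigO_of_nth_lt (J := J) ?_⟩
  · intro k l hkl
    have := hmono hkl
    dsimp only
    gcongr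
  · intro i k hi hk
    -- Block `i` alone already holds more than `k` elements, so earlier blocks can be ignored.
    refine Nat.nth_lt_of_lt_count ?_
    have hsub : (Finset.Ico (8 ^ i) (8 ^ (i + 1))).filter (· ∈ collisionFree S) ⊆
        (Finset.range (8 ^ (i + 1))).filter (· ∈ collisionFree S) :=
      Finset.filter_subset_filter _ fun n hn => Finset.mem_range.2 (Finset.mem_Ico.1 hn).2
    rw [Nat.count_eq_card_filter_range]
    exact_mod_cast (hk.trans_le (hJ i hi)).trans_le (Nat.cast_le.2 (Finset.card_le_card hsub))
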